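/- For real $\alpha_2,\alpha_3>0$ let $Q_{\alpha_2,\alpha_3}(x)=x_1^2+\alpha_2x_2^2-\alpha_3x_3^2$ for $x=(x_1,x_2,x_3)\in\mathbb Z^3$, and let $|x|$ denote the Euclidean norm. For almost every $(\alpha_2,\alpha_3)\in[\tfrac12,1]^2$, with respect to two-dimensional Lebesgue measure, the following holds (unconditionally): for every $\varepsilon>0$ there is a constant $C>0$, depending only on $\varepsilon,\alpha_2,\alpha_3$, such that for every real $N>1$ $$ \min_{\substack{x\in\mathbb Z^3\\ 0<|x|<N}}|Q_{\alpha_2,\alpha_3}(x)|\le C\,N^{-1+\varepsilon}. $$ -/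

import Mathlib

open MeasureTheory Set

/-- The ternary diagonal form `Q(x) = x₁² + α₂ x₂² - α₃ x₃²` at an integer vector. -/
noncomputable def diagForm (α₂ α₃ : ℝ) (x : Fin 3 → ℤ) : ℝ :=
  (x 0 : ℝ) ^ 2 + α₂ * (x 1 : ℝ) ^ 2 - α₃ * (x 2 : ℝ) ^ 2

/-- The Euclidean norm of an integer vector. -/
noncomputable def euclNorm (x : Fin 3 → ℤ) : ℝ :=
  ‖(WithLp.toLp 2 (fun i => (x i : ℝ)) : EuclideanSpace ℝ (Fin 3))‖

/-- The set of all `|Q(x)|` with `x ∈ ℤ³` and `0 < |x| < N`. -/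
def absValues (α₂ α₃ N : ℝ) : Set ℝ :=
  {v | ∃ x : Fin 3 → ℤ, 0 < euclNorm x ∧ euclNorm x < N ∧ v = |diagForm α₂ α₃ x|}

/-! The proof is a second moment argument in the parameter square. A triple with entries of size `M`
makes the form vanish on the line `α₃ = ratio x α₂`, and elsewhere the value of the form is `x₃²`
times the vertical distance to that line. So it suffices that for almost every parameter, at each
large dyadic `M`, some line passes within about `M ^ (-3 + ε)`.

Lines are counted with a window of width `κ` and a window of width `1 / M`, each of mass one. The
coarse count is at least `M³ / 2` everywhere on the square (`le_sum_window`). If no line is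
`κ`-close, the fine count is zero, so the difference `countDiff` has square at least `M⁶ / 4`. By
Chebyshev, a bound for the mean square of `countDiff` bounds the bad set.

The mean square is a sum over pairs of lines. Integration over `α₃` leaves the self-convolution of
the mean-zero kernel, evaluated at the gap between the lines, which is affine in `α₂`. Its integral
over `[1/2, 1]` vanishes unless the two lines are `2 / M`-close at an endpoint
(`abs_integral_comp_affine_le`). Only one in about `M` pairs is close there (`sum_closeAt_le`), and
a close pair costs the reciprocal of the slope difference, essentially `M²` over the determinant `x₂
y₃ - x₃ y₂`. Parallel pairs are bounded trivially. The reciprocal determinants sum to `O(M² log² M)`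
through the multiplicative energy of an interval (`sum_detWeight_le`).

Hence the bad set has measure `O(log² M / (κ M³))`, summable over `M = 2 ^ k` when `κ` is `M ^ (-3 +
ε) / 25`, and Borel–Cantelli concludes. -/

/-! ### Windows, the mean-zero kernel and its self-convolution. -/

/-- The normalised indicator function of `[-w, w]`. -/
noncomputable def window (w t : ℝ) : ℝ := (Icc (-w) w).indicator (fun _ => 1 / (2 * w)) t

/-- The difference of two normalised windows. -/
noncomputable def kern (v w t : ℝ) : ℝ := window v t - window w t

/-- The convolution square of a function on the line. -/
noncomputable def autoConv (K : ℝ → ℝ) (m : ℝ) : ℝ := ∫ t, K t * K (m - t)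

lemma window_nonneg {w : ℝ} (hw : 0 < w) (t : ℝ) : 0 ≤ window w t :=
  indicator_nonneg (fun _ _ => by positivity) t

lemma window_le {w : ℝ} (hw : 0 < w) (t : ℝ) : window w t ≤ 1 / (2 * w) :=
  indicator_le_self' (fun _ _ => by positivity) t

lemma window_of_abs_le {w t : ℝ} (h : |t| ≤ w) : window w t = 1 / (2 * w) :=
  indicator_of_mem (mem_Icc.mpr (abs_le.mp h)) _

lemma window_of_lt_abs {w t : ℝ} (h : w < |t|) : window w t = 0 :=
  indicator_of_notMem (fun h' => absurd (abs_le.mpr (mem_Icc.mp h')) (not_le.mpr h)) _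

lemma window_neg (w t : ℝ) : window w (-t) = window w t := by
  rcases le_or_gt |t| w with h | h
  · rw [window_of_abs_le h, window_of_abs_le (by rwa [abs_neg])]
  · rw [window_of_lt_abs h, window_of_lt_abs (by rwa [abs_neg])]

lemma measurable_window (w : ℝ) : Measurable (window w) :=
  measurable_const.indicator measurableSet_Icc

lemma integrable_window (w : ℝ) : Integrable (window w) :=
  (integrable_indicator_iff measurableSet_Icc).mpr
    (integrableOn_const (by simp) enorm_ne_top)

lemma integral_window {w : ℝ} (hw : 0 < w) : ∫ t, window w t = 1 := by
  unfold window
  rw [integral_indicator measurableSet_Icc, setIntegral_const]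
  simp only [smul_eq_mul, measureReal_def, Real.volume_Icc]
  rw [ENNReal.toReal_ofReal (by linarith)]
  field_simp
  ring

lemma kern_neg (v w t : ℝ) : kern v w (-t) = kern v w t := by
  simp only [kern, window_neg]

lemma measurable_kern (v w : ℝ) : Measurable (kern v w) :=
  (measurable_window v).sub (measurable_window w)

lemma integrable_kern (v w : ℝ) : Integrable (kern v w) :=
  (integrable_window v).sub (integrable_window w)

lemma integral_kern {v w : ℝ} (hv : 0 < v) (hw : 0 < w) : ∫ t, kern v w t = 0 := by
  unfold kern
  rw [integral_sub (integrable_window v) (integrable_window w), integral_window hv,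
    integral_window hw, sub_self]

lemma abs_kern_le {v w : ℝ} (hv : 0 < v) (hw : 0 < w) (t : ℝ) :
    |kern v w t| ≤ window v t + window w t := by
  have h1 := window_nonneg hv t
  have h2 := window_nonneg hw t
  unfold kern
  rw [abs_le]; constructor <;> linarith

lemma kern_of_lt_abs {v w t : ℝ} (hvw : v ≤ w) (h : w < |t|) : kern v w t = 0 := by
  rw [kern, window_of_lt_abs h, window_of_lt_abs (hvw.trans_lt h), sub_self]

lemma integral_abs_kern_le {v w : ℝ} (hv : 0 < v) (hw : 0 < w) : ∫ t, |kern v w t| ≤ 2 := by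
  calc ∫ t, |kern v w t| ≤ ∫ t, (window v t + window w t) :=
        integral_mono (integrable_kern v w).abs ((integrable_window v).add (integrable_window w))
          (abs_kern_le hv hw)
    _ = 2 := by
        rw [integral_add (integrable_window v) (integrable_window w), integral_window hv,
          integral_window hw]; norm_num

lemma integrable_mul_comp_sub {f g : ℝ → ℝ} (hf : Integrable f) (hg : Measurable g) {C : ℝ}
    (hC : ∀ t, |g t| ≤ C) (m : ℝ) : Integrable (fun t => f t * g (m - t)) := by
  refine (hf.mul_bdd (c := C) (hg.comp (measurable_const.sub measurable_id)).aestronglyMeasurable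
    (Filter.Eventually.of_forall fun t => ?_))
  simpa using hC (m - t)

lemma abs_kern_le_const {v w : ℝ} (hv : 0 < v) (hw : 0 < w) (t : ℝ) :
    |kern v w t| ≤ 1 / (2 * v) + 1 / (2 * w) :=
  (abs_kern_le hv hw t).trans (add_le_add (window_le hv t) (window_le hw t))

lemma autoConv_eq_convolution (K : ℝ → ℝ) :
    autoConv K = convolution K K (ContinuousLinearMap.mul ℝ ℝ) volume := rfl

lemma integrable_autoConv {K : ℝ → ℝ} (hK : Integrable K) : Integrable (autoConv K) := by
  rw [autoConv_eq_convolution]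
  exact hK.integrable_convolution _ hK

lemma integral_autoConv {K : ℝ → ℝ} (hK : Integrable K) :
    ∫ m, autoConv K m = (∫ t, K t) * ∫ t, K t := by
  rw [autoConv_eq_convolution, integral_convolution _ hK hK]
  rfl

lemma integral_abs_autoConv_le {K : ℝ → ℝ} (hK : Integrable K) :
    ∫ m, |autoConv K m| ≤ (∫ t, |K t|) * ∫ t, |K t| := by
  have h := integral_autoConv hK.abs
  rw [← h]
  refine integral_mono (integrable_autoConv hK).abs (integrable_autoConv hK.abs) fun m => ?_
  refine (abs_integral_le_integral_abs).trans_eq ?_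
  simp only [abs_mul, autoConv]

lemma autoConv_kern_of_lt_abs {v w m : ℝ} (hvw : v ≤ w) (h : 2 * w < |m|) :
    autoConv (kern v w) m = 0 := by
  unfold autoConv
  rw [← integral_zero ℝ ℝ]
  congr 1
  ext t
  rcases lt_or_ge w |t| with ht | ht
  · rw [kern_of_lt_abs hvw ht, zero_mul]
  · have : w < |m - t| := by
      have := abs_sub_abs_le_abs_sub m t
      linarith
    rw [kern_of_lt_abs hvw this, mul_zero]

/-- Of the four products of windows, only the one of two narrow windows can reach height `1 / (2 *
v)`, and it needs `|m| ≤ 2 * v`. Each of the other three is at most `1 / (2 * w)`. -/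
lemma abs_autoConv_kern_le {v w : ℝ} (hv : 0 < v) (hw : 0 < w) (m : ℝ) :
    |autoConv (kern v w) m| ≤ (if |m| ≤ 2 * v then 1 / (2 * v) else 0) + 3 / (2 * w) := by
  set A : ℝ := if |m| ≤ 2 * v then 1 / (2 * v) else 0 with hA
  have hpt : ∀ t, |kern v w t * kern v w (m - t)| ≤
      A * window v t + (1 / (2 * w)) * window v t + window w t * (window v (m - t)) + (1 / (2 * w)) * window w t := by
    intro t
    rw [abs_mul]
    have h1 := window_nonneg hv t
    have h2 := window_nonneg hw t
    have h3 := window_nonneg hv (m - t)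
    have h4 := window_nonneg hw (m - t)
    have h5 := window_le hw (m - t)
    have key : window v t * window v (m - t) ≤ A * window v t := by
      rcases le_or_gt |m| (2 * v) with hm | hm
      · rw [hA, if_pos hm, mul_comm]
        exact mul_le_mul_of_nonneg_right (window_le hv _) h1
      · rw [hA, if_neg (not_le.mpr hm), zero_mul]
        rcases lt_or_ge v |t| with ht | ht
        · rw [window_of_lt_abs ht, zero_mul]
        · have : v < |m - t| := by
            have := abs_sub_abs_le_abs_sub m t
            linarith
          rw [window_of_lt_abs this, mul_zero]
    calc |kern v w t| * |kern v w (m - t)|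
        ≤ (window v t + window w t) * (window v (m - t) + window w (m - t)) :=
          mul_le_mul (abs_kern_le hv hw t) (abs_kern_le hv hw _) (abs_nonneg _) (by positivity)
      _ ≤ _ := by nlinarith [mul_le_mul_of_nonneg_left h5 h1, mul_le_mul_of_nonneg_left h5 h2]
  have hi1 := integrable_window v
  have hi2 := integrable_window w
  have hi3 : Integrable (fun t => window v (m - t)) := hi1.comp_sub_left m
  have hpt' : ∀ t, |kern v w t * kern v w (m - t)| ≤
      (A + 1 / (2 * w)) * window v t + (1 / (2 * w)) * window v (m - t)
        + (1 / (2 * w)) * window w t := by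
    intro t
    have := mul_le_mul_of_nonneg_right (window_le hw t) (window_nonneg hv (m - t))
    linarith [hpt t]
  calc |autoConv (kern v w) m| ≤ ∫ t, |kern v w t * kern v w (m - t)| :=
        abs_integral_le_integral_abs
    _ ≤ ∫ t, ((A + 1 / (2 * w)) * window v t + (1 / (2 * w)) * window v (m - t)
        + (1 / (2 * w)) * window w t) := by
        refine integral_mono (integrable_mul_comp_sub (integrable_kern v w) (measurable_kern v w)
          (abs_kern_le_const hv hw) m).abs ?_ hpt'
        exact ((hi1.const_mul _).add (hi3.const_mul _)).add (hi2.const_mul _)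
    _ = A + 3 / (2 * w) := by
        have hi4 : Integrable (fun t => (A + 1 / (2 * w)) * window v t +
            (1 / (2 * w)) * window v (m - t)) := (hi1.const_mul _).add (hi3.const_mul _)
        rw [integral_add hi4 (hi2.const_mul _),
          integral_add (hi1.const_mul _) (hi3.const_mul _), integral_const_mul,
          integral_const_mul, integral_const_mul, integral_sub_left_eq_self (window v) volume m,
          integral_window hv, integral_window hw]
        ring

/-! ### Integrals of mean-zero functions along affine maps. -/

/-- An integrable function of mean zero supported in `[-S, S]` has zero integral over every
interval whose end points lie outside `[-S, S]`. -/
lemma intervalIntegral_eq_zero_of_support {H : ℝ → ℝ} {S : ℝ}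
    (h0 : ∫ m, H m = 0) (hS : ∀ m, S < |m| → H m = 0) {a b : ℝ} (hab : a ≤ b)
    (ha : S < |a|) (hb : S < |b|) : ∫ m in a..b, H m = 0 := by
  rw [intervalIntegral.integral_of_le hab]
  rcases lt_abs.mp ha with h | h
  · refine setIntegral_eq_zero_of_forall_eq_zero fun m hm => hS m ?_
    exact (h.trans hm.1).trans_le (le_abs_self m)
  rcases lt_abs.mp hb with h' | h'
  · rw [← h0]
    refine setIntegral_eq_integral_of_forall_compl_eq_zero fun m hm => hS m ?_
    rcases le_or_gt m a with hma | hma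
    · exact lt_abs.mpr (Or.inr (by linarith))
    · have : b < m := by
        by_contra hcon
        exact hm ⟨hma, not_lt.mp hcon⟩
      exact lt_abs.mpr (Or.inl (by linarith))
  · refine setIntegral_eq_zero_of_forall_eq_zero fun m hm => hS m ?_
    exact lt_abs.mpr (Or.inr (by linarith [hm.2]))

/-- If both endpoints map outside `[-S, S]`, the image interval contains either all of the support
or none of it, and the mean-zero condition gives zero. Only boundary terms survive. -/
lemma abs_integral_comp_affine_le {H : ℝ → ℝ} {S : ℝ} (hH : Integrable H)
    (h0 : ∫ m, H m = 0) (hS : ∀ m, S < |m| → H m = 0) {E D a b : ℝ} (hD : D ≠ 0) :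
    |∫ t in a..b, H (E + D * t)| ≤ |D|⁻¹ * (∫ m, |H m|) *
      ((if |E + D * a| ≤ S then 1 else 0) + (if |E + D * b| ≤ S then 1 else 0)) := by
  rw [intervalIntegral.integral_comp_add_mul H hD E, smul_eq_mul, abs_mul, abs_inv, mul_assoc]
  refine mul_le_mul_of_nonneg_left ?_ (by positivity)
  have hI : 0 ≤ ∫ m, |H m| := integral_nonneg fun _ => abs_nonneg _
  have hle : |∫ m in E + D * a..E + D * b, H m| ≤ ∫ m, |H m| := by
    refine (intervalIntegral.norm_integral_le_integral_norm_uIoc (f := H) (μ := volume)).trans ?_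
    exact setIntegral_le_integral hH.abs (Filter.Eventually.of_forall fun _ => abs_nonneg _)
  by_cases hb : |E + D * a| ≤ S <;> by_cases hb' : |E + D * b| ≤ S
  · rw [if_pos hb, if_pos hb']; linarith
  · rw [if_pos hb, if_neg hb']; linarith
  · rw [if_neg hb, if_pos hb']; linarith
  · rw [if_neg hb, if_neg hb', add_zero, mul_zero]
    push Not at hb hb'
    rcases le_total (E + D * a) (E + D * b) with h | h
    · rw [intervalIntegral_eq_zero_of_support h0 hS h hb hb', abs_zero]
    · rw [intervalIntegral.integral_symm,
        intervalIntegral_eq_zero_of_support h0 hS h hb' hb, neg_zero, abs_zero]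

/-! ### Arithmetic counting: squares, gcd sums and multiplicative energy. -/

/-- Two admissible `y` have squares differing by at most `(4 / M) * (5 * M)² = 100 * M`, while their
sum is at least `2 * M`. So they differ by at most 50. -/
lemma card_filter_sq_near_le {M z : ℕ} (hM : 0 < M) (hz : z ∈ Finset.Icc M (5 * M)) (A B : ℝ) :
    ((Finset.Icc M (5 * M)).filter
      (fun y : ℕ => |A - ((y : ℝ) ^ 2 + B) / (z : ℝ) ^ 2| ≤ 2 / M)).card ≤ 51 := by
  set s := (Finset.Icc M (5 * M)).filter
      (fun y : ℕ => |A - ((y : ℝ) ^ 2 + B) / (z : ℝ) ^ 2| ≤ 2 / M) with hs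
  have hM' : (0 : ℝ) < M := by exact_mod_cast hM
  obtain ⟨hz1, hz2⟩ := Finset.mem_Icc.mp hz
  have hz1' : (M : ℝ) ≤ z := by exact_mod_cast hz1
  have hz2' : (z : ℝ) ≤ 5 * M := by exact_mod_cast hz2
  have hz0 : (0 : ℝ) < z := hM'.trans_le hz1'
  rcases s.eq_empty_or_nonempty with h | h
  · simp [h]
  have hsub : s ⊆ Finset.Icc (s.min' h) (s.min' h + 50) := by
    intro y hy
    have hle := s.min'_le y hy
    have hy0 := s.min'_mem h
    set y0 := s.min' h
    rw [hs, Finset.mem_filter, Finset.mem_Icc, abs_le] at hy hy0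
    refine Finset.mem_Icc.mpr ⟨hle, ?_⟩
    have h1 : ((y : ℝ) ^ 2 - (y0 : ℝ) ^ 2) / (z : ℝ) ^ 2 ≤ 4 / M := by
      have e1 : ((y : ℝ) ^ 2 - (y0 : ℝ) ^ 2) / (z : ℝ) ^ 2 =
        ((y : ℝ) ^ 2 + B) / (z : ℝ) ^ 2 - ((y0 : ℝ) ^ 2 + B) / (z : ℝ) ^ 2 := by ring
      have e2 : (4 : ℝ) / M = 2 / M + 2 / M := by ring
      linarith [hy.2.1, hy.2.2, hy0.2.1, hy0.2.2]
    rw [div_le_div_iff₀ (by positivity) hM'] at h1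
    have h2 : ((y : ℝ) ^ 2 - (y0 : ℝ) ^ 2) * M ≤ 100 * M * M := by nlinarith
    have h3 : (y : ℝ) ^ 2 - (y0 : ℝ) ^ 2 ≤ 100 * M := le_of_mul_le_mul_right h2 hM'
    have hy1 : (M : ℝ) ≤ y := by exact_mod_cast hy.1.1
    have hy2 : (M : ℝ) ≤ y0 := by exact_mod_cast hy0.1.1
    have h4 : (y : ℝ) ≤ y0 + 50 := by
      by_contra hcon
      push Not at hcon
      nlinarith
    exact_mod_cast h4
  refine (Finset.card_le_card hsub).trans ?_
  simp; omega

/-- Replacing the gcd by the sum of all common divisors decouples `a` from `b`. -/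
lemma sum_gcd_le (L : ℕ) :
    ∑ a ∈ Finset.Ioc 0 L, ∑ b ∈ Finset.Ioc 0 L, (Nat.gcd a b : ℝ) ≤ (L : ℝ) ^ 2 * harmonic L := by
  have h1 : ∀ a ∈ Finset.Ioc 0 L, ∀ b ∈ Finset.Ioc 0 L, (Nat.gcd a b : ℝ) ≤
      ∑ g ∈ Finset.Ioc 0 L, (g : ℝ) * ((if g ∣ a then 1 else 0) * (if g ∣ b then 1 else 0)) := by
    intro a ha b hb
    rw [Finset.mem_Ioc] at ha hb
    have hg : Nat.gcd a b ∈ Finset.Ioc 0 L := by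
      refine Finset.mem_Ioc.mpr ⟨Nat.gcd_pos_of_pos_left _ ha.1, ?_⟩
      exact (Nat.gcd_le_left _ ha.1).trans ha.2
    refine le_trans ?_ (Finset.single_le_sum (fun g _ => ?_) hg)
    · simp [Nat.gcd_dvd_left, Nat.gcd_dvd_right]
    · positivity
  have hc : ∀ g : ℕ, ∑ a ∈ Finset.Ioc 0 L, (if g ∣ a then (1 : ℝ) else 0) = ((L / g : ℕ) : ℝ) := by
    intro g
    rw [Finset.sum_boole, Nat.Ioc_filter_dvd_card_eq_div]
  calc ∑ a ∈ Finset.Ioc 0 L, ∑ b ∈ Finset.Ioc 0 L, (Nat.gcd a b : ℝ)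
      ≤ ∑ a ∈ Finset.Ioc 0 L, ∑ b ∈ Finset.Ioc 0 L, ∑ g ∈ Finset.Ioc 0 L,
          (g : ℝ) * ((if g ∣ a then 1 else 0) * (if g ∣ b then 1 else 0)) :=
        Finset.sum_le_sum fun a ha => Finset.sum_le_sum fun b hb => h1 a ha b hb
    _ = ∑ g ∈ Finset.Ioc 0 L, (g : ℝ) * (((L / g : ℕ) : ℝ) * ((L / g : ℕ) : ℝ)) := by
        simp_rw [fun a => Finset.sum_comm (s := Finset.Ioc 0 L) (t := Finset.Ioc 0 L)
          (f := fun b g : ℕ => (g : ℝ) * ((if g ∣ a then (1 : ℝ) else 0) * (if g ∣ b then 1 else 0)))]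
        rw [Finset.sum_comm]
        refine Finset.sum_congr rfl fun g _ => ?_
        simp_rw [← Finset.mul_sum]
        rw [← Finset.sum_mul, hc]
    _ ≤ ∑ g ∈ Finset.Ioc 0 L, (L : ℝ) ^ 2 * (g : ℝ)⁻¹ := by
        refine Finset.sum_le_sum fun g hg => ?_
        have hg0 : (0 : ℝ) < g := by exact_mod_cast (Finset.mem_Ioc.mp hg).1
        have h2 : ((L / g : ℕ) : ℝ) ≤ L / g := Nat.cast_div_le
        calc (g : ℝ) * (((L / g : ℕ) : ℝ) * ((L / g : ℕ) : ℝ)) ≤ g * ((L / g) * (L / g)) := by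
              gcongr
          _ = _ := by field_simp
    _ = _ := by
        rw [← Finset.mul_sum, harmonic_eq_sum_Icc]
        push_cast
        rfl

/-- The second coordinate is a multiple of `a / gcd a b` and determines the first. Since `a ≥ M`,
the interval up to `5 * M` holds at most `5 * gcd a b` such multiples. -/
lemma card_proportional_le {M a b : ℕ} (ha : a ∈ Finset.Icc M (5 * M)) (hM : 0 < M) :
    (((Finset.Icc M (5 * M)) ×ˢ (Finset.Icc M (5 * M))).filter
      (fun q : ℕ × ℕ => a * q.1 = b * q.2)).card ≤ 5 * Nat.gcd a b := by
  obtain ⟨ha1, ha2⟩ := Finset.mem_Icc.mp ha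
  have ha0 : 0 < a := by omega
  have hg0 : 0 < Nat.gcd a b := Nat.gcd_pos_of_pos_left _ ha0
  have hd : 0 < a / Nat.gcd a b := Nat.div_pos (Nat.gcd_le_left _ ha0) hg0
  calc _ ≤ ((Finset.Ioc 0 (5 * M)).filter (fun c => a / Nat.gcd a b ∣ c)).card := by
        refine Finset.card_le_card_of_injOn Prod.snd ?_ ?_
        · intro q hq
          simp only [Finset.coe_filter, Finset.mem_product, Finset.mem_Icc, Set.mem_ofPred_eq,
            Finset.mem_Ioc] at hq ⊢
          refine ⟨⟨by omega, hq.1.2.2⟩, ?_⟩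
          have h1 : a ∣ b * q.2 := ⟨q.1, hq.2.symm⟩
          exact (Nat.Coprime.dvd_of_dvd_mul_left (Nat.coprime_div_gcd_div_gcd hg0)
            (by
              refine Nat.dvd_of_mul_dvd_mul_left hg0 ?_
              rw [← mul_assoc, Nat.mul_div_cancel' (Nat.gcd_dvd_left a b),
                Nat.mul_div_cancel' (Nat.gcd_dvd_right a b)]
              exact h1))
        · intro q hq q' hq' h
          simp only [Finset.coe_filter, Set.mem_ofPred_eq] at hq hq'
          have h2 : a * q.1 = a * q'.1 := by rw [hq.2, hq'.2, h]
          exact Prod.ext (Nat.eq_of_mul_eq_mul_left ha0 h2) h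
    _ = 5 * M / (a / Nat.gcd a b) := Nat.Ioc_filter_dvd_card_eq_div _ _
    _ ≤ 5 * Nat.gcd a b := by
        refine Nat.div_le_of_le_mul ?_
        have := Nat.div_mul_cancel (Nat.gcd_dvd_left a b)
        nlinarith

/-- The number of representations of `m` as a product of two elements of `s`. -/
def mulRep (s : Finset ℕ) (m : ℕ) : ℕ := ((s ×ˢ s).filter (fun p : ℕ × ℕ => p.1 * p.2 = m)).card

lemma sum_mul_eq_sum_mulRep {s : Finset ℕ} {L : ℕ} (hs : ∀ a ∈ s, a ≤ L) (f : ℕ → ℝ) :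
    ∑ p ∈ s ×ˢ s, f (p.1 * p.2) = ∑ m ∈ Finset.range (L * L + 1), (mulRep s m : ℝ) * f m := by
  have hmaps : ∀ p ∈ s ×ˢ s, p.1 * p.2 ∈ Finset.range (L * L + 1) := by
    intro p hp
    rw [Finset.mem_product] at hp
    exact Finset.mem_range.mpr (Nat.lt_succ_of_le (Nat.mul_le_mul (hs _ hp.1) (hs _ hp.2)))
  rw [← Finset.sum_fiberwise_of_maps_to' hmaps f]
  refine Finset.sum_congr rfl fun m _ => ?_
  rw [Finset.sum_const, nsmul_eq_mul]
  rfl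

lemma sum_inv_dist_le {L m : ℕ} (hm : m ≤ L) :
    ∑ n ∈ Finset.range (L + 1), (max 1 |(m : ℝ) - n|)⁻¹ ≤ 1 + 2 * (harmonic L : ℝ) := by
  have h1 : ∑ n ∈ Finset.range (m + 1), (max 1 |(m : ℝ) - n|)⁻¹ ≤ 1 + (harmonic L : ℝ) := by
    rw [← Finset.sum_range_reflect, Finset.sum_range_succ']
    have h0 : (max 1 |(m : ℝ) - ((m + 1 - 1 - 0 : ℕ) : ℝ)|)⁻¹ = 1 := by simp
    rw [h0, add_comm, harmonic]
    push_cast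
    gcongr ?_ + ?_
    · exact le_rfl
    refine (Finset.sum_le_sum (f := _) (g := fun i : ℕ => ((i : ℝ) + 1)⁻¹) fun i hi => ?_).trans
      (Finset.sum_le_sum_of_subset_of_nonneg (Finset.range_mono hm) fun _ _ _ => by positivity)
    have hi' := Finset.mem_range.mp hi
    have e : (m : ℝ) - ((m - (i + 1) : ℕ) : ℝ) = i + 1 := by
      rw [Nat.cast_sub (by omega)]; push_cast; ring
    rw [e]
    gcongr
    exact (le_abs_self _).trans (le_max_right _ _)
  have h2 : ∑ n ∈ Finset.Ico (m + 1) (L + 1), (max 1 |(m : ℝ) - n|)⁻¹ ≤ (harmonic L : ℝ) := by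
    rw [Finset.sum_Ico_eq_sum_range, harmonic]
    push_cast
    refine (Finset.sum_le_sum (f := _) (g := fun i : ℕ => ((i : ℝ) + 1)⁻¹) fun i hi => ?_).trans
      (Finset.sum_le_sum_of_subset_of_nonneg (Finset.range_mono (by omega))
        fun _ _ _ => by positivity)
    have e : (m : ℝ) - (m + 1 + i) = -(i + 1) := by ring
    rw [e, abs_neg]
    gcongr
    exact (le_abs_self _).trans (le_max_right _ _)
  rw [← Finset.sum_range_add_sum_Ico _ (show m + 1 ≤ L + 1 by omega)]
  linarith

/-- This is Schur's test: grouped by the values of the products, the sum is a quadratic form in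
`mulRep` whose kernel has row sums of logarithmic size. What remains is the `ℓ²` norm of `mulRep`,
the multiplicative energy. -/
lemma sum_inv_dist_mul_le {s : Finset ℕ} {L : ℕ} (hs : ∀ a ∈ s, a ≤ L) :
    ∑ p ∈ s ×ˢ s, ∑ q ∈ s ×ˢ s, (max 1 |((p.1 * p.2 : ℕ) : ℝ) - ((q.1 * q.2 : ℕ) : ℝ)|)⁻¹ ≤
      (∑ p ∈ s ×ˢ s, (mulRep s (p.1 * p.2) : ℝ)) * (1 + 2 * (harmonic (L * L) : ℝ)) := by
  set R := Finset.range (L * L + 1) with hR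
  set φ : ℕ → ℕ → ℝ := fun m n => (max 1 |(m : ℝ) - n|)⁻¹ with hφ
  have hφ0 : ∀ m n, 0 ≤ φ m n := fun m n => by positivity
  have hsymm : ∀ m n, φ m n = φ n m := fun m n => by simp only [hφ, abs_sub_comm]
  calc ∑ p ∈ s ×ˢ s, ∑ q ∈ s ×ˢ s, φ (p.1 * p.2) (q.1 * q.2)
      = ∑ m ∈ R, ∑ n ∈ R, (mulRep s m : ℝ) * ((mulRep s n : ℝ) * φ m n) := by
        rw [sum_mul_eq_sum_mulRep hs (fun m => ∑ q ∈ s ×ˢ s, φ m (q.1 * q.2))]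
        refine Finset.sum_congr rfl fun m _ => ?_
        rw [sum_mul_eq_sum_mulRep hs (fun n => φ m n), Finset.mul_sum]
    -- The inequality `u * v ≤ (u² + v²) / 2`; the two halves agree by symmetry of `φ`.
    _ ≤ ∑ m ∈ R, ∑ n ∈ R, ((mulRep s m : ℝ) ^ 2 * φ m n / 2 + (mulRep s n : ℝ) ^ 2 * φ n m / 2) := by
        refine Finset.sum_le_sum fun m _ => Finset.sum_le_sum fun n _ => ?_
        rw [hsymm n m]
        nlinarith [mul_nonneg (sq_nonneg ((mulRep s m : ℝ) - mulRep s n)) (hφ0 m n)]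
    _ = ∑ m ∈ R, ∑ n ∈ R, (mulRep s m : ℝ) ^ 2 * φ m n := by
        simp_rw [Finset.sum_add_distrib]
        rw [Finset.sum_comm (f := fun m n => (mulRep s n : ℝ) ^ 2 * φ n m / 2),
          ← Finset.sum_add_distrib]
        refine Finset.sum_congr rfl fun m _ => ?_
        rw [← Finset.sum_add_distrib]
        exact Finset.sum_congr rfl fun n _ => by ring
    _ ≤ ∑ m ∈ R, (mulRep s m : ℝ) * (mulRep s m : ℝ) * (1 + 2 * (harmonic (L * L) : ℝ)) := by
        refine Finset.sum_le_sum fun m hm => ?_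
        rw [← Finset.mul_sum, sq]
        refine mul_le_mul_of_nonneg_left (sum_inv_dist_le ?_) (by positivity)
        exact Nat.lt_succ_iff.mp (Finset.mem_range.mp hm)
    _ = _ := by
        rw [← Finset.sum_mul, sum_mul_eq_sum_mulRep hs (fun m => (mulRep s m : ℝ))]

/-- The left side counts multiplicative quadruples. Rearranged as proportional pairs, they number at
most `5 * gcd a b` for each `a`, `b`. -/
lemma sum_mulRep_le {M : ℕ} (hM : 0 < M) :
    ∑ p ∈ Finset.Icc M (5 * M) ×ˢ Finset.Icc M (5 * M),
      (mulRep (Finset.Icc M (5 * M)) (p.1 * p.2) : ℝ) ≤ 125 * (M : ℝ) ^ 2 * harmonic (5 * M) := by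
  set s := Finset.Icc M (5 * M) with hs
  have hsub : s ⊆ Finset.Ioc 0 (5 * M) := by
    intro a ha
    rw [hs, Finset.mem_Icc] at ha
    exact Finset.mem_Ioc.mpr ⟨by omega, ha.2⟩
  have e : ∑ p ∈ s ×ˢ s, (mulRep s (p.1 * p.2) : ℝ) = ∑ a ∈ s, ∑ b ∈ s,
      (((s ×ˢ s).filter (fun q : ℕ × ℕ => a * q.1 = b * q.2)).card : ℝ) := by
    have h1 : ∀ p : ℕ × ℕ, (mulRep s (p.1 * p.2) : ℝ) =
        ∑ b ∈ s, ∑ c ∈ s, if b * c = p.1 * p.2 then (1 : ℝ) else 0 := by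
      intro p
      rw [mulRep, ← Finset.sum_boole, Finset.sum_product]
    have h2 : ∀ a b : ℕ, (((s ×ˢ s).filter (fun q : ℕ × ℕ => a * q.1 = b * q.2)).card : ℝ) =
        ∑ e ∈ s, ∑ c ∈ s, if a * e = b * c then (1 : ℝ) else 0 := by
      intro a b
      rw [← Finset.sum_boole, Finset.sum_product]
    simp_rw [h1, h2]
    rw [Finset.sum_product]
    refine Finset.sum_congr rfl fun a _ => ?_
    rw [Finset.sum_comm]
    refine Finset.sum_congr rfl fun b _ => Finset.sum_congr rfl fun e _ =>
      Finset.sum_congr rfl fun c _ => ?_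
    simp only [eq_comm]
  rw [e]
  calc _ ≤ ∑ a ∈ s, ∑ b ∈ s, 5 * (Nat.gcd a b : ℝ) := by
        refine Finset.sum_le_sum fun a ha => Finset.sum_le_sum fun b _ => ?_
        exact_mod_cast card_proportional_le ha hM
    _ ≤ ∑ a ∈ Finset.Ioc 0 (5 * M), ∑ b ∈ Finset.Ioc 0 (5 * M), 5 * (Nat.gcd a b : ℝ) := by
        refine (Finset.sum_le_sum fun a _ => Finset.sum_le_sum_of_subset_of_nonneg hsub
          fun _ _ _ => by positivity).trans
          (Finset.sum_le_sum_of_subset_of_nonneg hsub fun _ _ _ => by positivity)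
    _ ≤ 5 * (((5 * M : ℕ) : ℝ) ^ 2 * harmonic (5 * M)) := by
        simp_rw [← Finset.mul_sum]
        exact mul_le_mul_of_nonneg_left (sum_gcd_le (5 * M)) (by norm_num)
    _ = _ := by push_cast; ring

/-! ### Correlation of two zero lines. -/

/-- The value of `α₃` for which the form `diagForm α₂ α₃` vanishes at `x`, when `α₂ = t`. -/
noncomputable def ratio (x : ℕ × ℕ × ℕ) (t : ℝ) : ℝ :=
  ((x.1 : ℝ) ^ 2 + t * (x.2.1 : ℝ) ^ 2) / (x.2.2 : ℝ) ^ 2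

/-- The triples with all entries in `[M, 5M]`. -/
def tripleBox (M : ℕ) : Finset (ℕ × ℕ × ℕ) :=
  Finset.Icc M (5 * M) ×ˢ Finset.Icc M (5 * M) ×ˢ Finset.Icc M (5 * M)

/-- The indicator of the event that the zero lines of `x` and `y` are `2 / M`-close at `t`. -/
noncomputable def closeAt (M : ℕ) (x y : ℕ × ℕ × ℕ) (t : ℝ) : ℝ :=
  if |ratio x t - ratio y t| ≤ 2 / M then 1 else 0

/-- The truncated reciprocal of the determinant `x₂ y₃ - x₃ y₂`. -/
noncomputable def detWeight (p q : ℕ × ℕ) : ℝ :=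
  (max 1 |((p.1 * q.2 : ℕ) : ℝ) - ((p.2 * q.1 : ℕ) : ℝ)|)⁻¹

lemma closeAt_nonneg (M : ℕ) (x y : ℕ × ℕ × ℕ) (t : ℝ) : 0 ≤ closeAt M x y t := by
  unfold closeAt; split_ifs <;> norm_num

lemma detWeight_nonneg (p q : ℕ × ℕ) : 0 ≤ detWeight p q := by
  unfold detWeight; positivity

lemma ratio_sub_ratio (x y : ℕ × ℕ × ℕ) (t : ℝ) :
    ratio y t - ratio x t = (ratio y 0 - ratio x 0) +
      ((y.2.1 : ℝ) ^ 2 / (y.2.2 : ℝ) ^ 2 - (x.2.1 : ℝ) ^ 2 / (x.2.2 : ℝ) ^ 2) * t := by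
  unfold ratio; ring

lemma le_cast_of_mem {M a : ℕ} (ha : a ∈ Finset.Icc M (5 * M)) :
    (M : ℝ) ≤ a ∧ (a : ℝ) ≤ 5 * M := by
  rw [Finset.mem_Icc] at ha
  exact ⟨by exact_mod_cast ha.1, by exact_mod_cast ha.2⟩

/-- The difference of squared fractions factors as the determinant times `(a * e + b * c) / (e² *
b²)`, and the latter is at least `2 * M² / (5 * M)⁴`. -/
lemma le_abs_slope {M a b c e : ℕ} (hM : 0 < M) (ha : a ∈ Finset.Icc M (5 * M))
    (hb : b ∈ Finset.Icc M (5 * M)) (hc : c ∈ Finset.Icc M (5 * M))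
    (he : e ∈ Finset.Icc M (5 * M)) :
    |((a * e : ℕ) : ℝ) - ((b * c : ℕ) : ℝ)| * 2 ≤
      |(c : ℝ) ^ 2 / (e : ℝ) ^ 2 - (a : ℝ) ^ 2 / (b : ℝ) ^ 2| * (625 * (M : ℝ) ^ 2) := by
  have hM' : (0 : ℝ) < M := by exact_mod_cast hM
  obtain ⟨ha1, ha2⟩ := le_cast_of_mem ha
  obtain ⟨hb1, hb2⟩ := le_cast_of_mem hb
  obtain ⟨hc1, hc2⟩ := le_cast_of_mem hc
  obtain ⟨he1, he2⟩ := le_cast_of_mem he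
  have hb0 := hM'.trans_le hb1
  have he0 := hM'.trans_le he1
  have ha0 := hM'.trans_le ha1
  have hc0 := hM'.trans_le hc1
  have e1 : (c : ℝ) ^ 2 / (e : ℝ) ^ 2 - (a : ℝ) ^ 2 / (b : ℝ) ^ 2 =
      -(((a * e : ℕ) : ℝ) - ((b * c : ℕ) : ℝ)) * ((a * e + b * c) / ((e : ℝ) ^ 2 * (b : ℝ) ^ 2)) := by
    push_cast
    field_simp
    ring
  have h1 : 2 ≤ ((a * e + b * c : ℝ) / ((e : ℝ) ^ 2 * (b : ℝ) ^ 2)) * (625 * (M : ℝ) ^ 2) := by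
    rw [div_mul_eq_mul_div, le_div_iff₀ (by positivity)]
    have h2 : (M : ℝ) ^ 2 ≤ a * e := by rw [sq]; gcongr
    have h3 : (M : ℝ) ^ 2 ≤ b * c := by rw [sq]; gcongr
    have h4 : (e : ℝ) ^ 2 * (b : ℝ) ^ 2 ≤ (5 * M) ^ 2 * (5 * M) ^ 2 := by gcongr
    have h5 : (M : ℝ) ^ 2 * 2 * (625 * (M : ℝ) ^ 2) ≤ (a * e + b * c) * (625 * (M : ℝ) ^ 2) := by
      gcongr; linarith
    nlinarith
  rw [e1, abs_mul, abs_neg, abs_of_nonneg (show (0 : ℝ) ≤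
    (a * e + b * c) / ((e : ℝ) ^ 2 * (b : ℝ) ^ 2) by positivity), mul_assoc]
  exact mul_le_mul_of_nonneg_left h1 (abs_nonneg _)

/-- The radius `2 / M` in `closeAt` is that of the support of the self-convolution, twice the coarse
width. The term `M` is needed only for parallel lines. -/
lemma abs_integral_pair_le {M : ℕ} (hM : 0 < M) {κ : ℝ} (hκ : 0 < κ) (hκM : (M : ℝ) ^ 2 * κ ≤ 1)
    {x y : ℕ × ℕ × ℕ} (hx : x ∈ tripleBox M) (hy : y ∈ tripleBox M) :
    |∫ t in (1 / 2 : ℝ)..1, autoConv (kern κ (1 / M)) (ratio y t - ratio x t)| ≤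
      detWeight x.2 y.2 * (1250 / κ * (closeAt M x y (1 / 2) + closeAt M x y 1) + M) := by
  have hM' : (1 : ℝ) ≤ M := by exact_mod_cast hM
  have hw : (0 : ℝ) < 1 / M := by positivity
  have hκw : κ ≤ 1 / M := by
    rw [le_div_iff₀ (by linarith)]
    nlinarith [mul_nonneg hκ.le (show (0 : ℝ) ≤ M * (M - 1) by nlinarith)]
  simp only [tripleBox, Finset.mem_product] at hx hy
  have hslope := le_abs_slope hM hx.2.1 hx.2.2 hy.2.1 hy.2.2
  have hS : ∀ m, 2 / (M : ℝ) < |m| → autoConv (kern κ (1 / M)) m = 0 := fun m hm =>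
    autoConv_kern_of_lt_abs hκw (by rwa [mul_one_div])
  have hH := integrable_autoConv (integrable_kern κ (1 / M))
  have hca : ∀ t, (if |ratio y t - ratio x t| ≤ 2 / (M : ℝ) then (1 : ℝ) else 0) =
      closeAt M x y t := fun t => by rw [closeAt, abs_sub_comm]
  have hp := closeAt_nonneg M x y (1 / 2)
  have hq := closeAt_nonneg M x y 1
  -- Zero determinant means parallel lines: the gap is constant in `t`, no cancellation is
  -- available, and the pointwise bound is used.
  by_cases hd : ((x.2.1 * y.2.2 : ℕ) : ℝ) - ((x.2.2 * y.2.1 : ℕ) : ℝ) = 0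
  · have hw1 : detWeight x.2 y.2 = 1 := by
      rw [detWeight, hd, abs_zero, max_eq_left zero_le_one, inv_one]
    have hd' : (y.2.1 : ℝ) ^ 2 / (y.2.2 : ℝ) ^ 2 - (x.2.1 : ℝ) ^ 2 / (x.2.2 : ℝ) ^ 2 = 0 := by
      have h1 := (le_cast_of_mem hx.2.2).1
      have h2 := (le_cast_of_mem hy.2.2).1
      have h3 : (0 : ℝ) < x.2.2 := by linarith
      have h4 : (0 : ℝ) < y.2.2 := by linarith
      push_cast at hd
      rw [sub_eq_zero, div_eq_div_iff (by positivity) (by positivity), ← mul_pow, ← mul_pow]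
      congr 1
      linarith
    have hconst : ∀ t, ratio y t - ratio x t = ratio y 1 - ratio x 1 := by
      intro t
      rw [ratio_sub_ratio x y t, ratio_sub_ratio x y 1, hd']; ring
    simp_rw [hconst]
    rw [intervalIntegral.integral_const, smul_eq_mul, abs_mul, hw1, one_mul]
    have h1 := abs_autoConv_kern_le hκ hw (ratio y 1 - ratio x 1)
    have h2 : (if |ratio y 1 - ratio x 1| ≤ 2 * κ then 1 / (2 * κ) else 0) ≤
        1 / (2 * κ) * closeAt M x y 1 := by
      rw [← hca 1]
      split_ifs with h3 h4 h4
      · simp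
      · exact absurd (h3.trans (by rw [← mul_one_div]; linarith)) h4
      · simp [hκ.le]
      · simp
    have h5 : 3 / (2 * (1 / (M : ℝ))) = 3 / 2 * M := by field_simp
    rw [h5] at h1
    have h6 : |(1 : ℝ) - 1 / 2| = 1 / 2 := by norm_num
    rw [h6]
    have h7 : 1 / (2 * κ) * closeAt M x y 1 ≤ 1250 / κ * closeAt M x y 1 := by
      refine mul_le_mul_of_nonneg_right ?_ hq
      rw [div_le_div_iff₀ (by positivity) hκ]; linarith
    have h8 : 0 ≤ 1250 / κ * closeAt M x y (1 / 2) := by positivity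
    have h9 : 0 ≤ 1250 / κ * closeAt M x y 1 := by positivity
    rw [mul_add]
    linarith
  · set d := ((x.2.1 * y.2.2 : ℕ) : ℝ) - ((x.2.2 * y.2.1 : ℕ) : ℝ) with hdd
    have hd1 : 1 ≤ |d| := by
      have e : d = (((x.2.1 * y.2.2 : ℕ) : ℤ) - ((x.2.2 * y.2.1 : ℕ) : ℤ) : ℤ) := by
        rw [hdd]; push_cast; ring
      rw [e, ← Int.cast_abs]
      rw [e] at hd
      exact_mod_cast Int.one_le_abs (by exact_mod_cast hd)
    have hw1 : detWeight x.2 y.2 = |d|⁻¹ := by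
      rw [detWeight, ← hdd, max_eq_right hd1]
    set D := (y.2.1 : ℝ) ^ 2 / (y.2.2 : ℝ) ^ 2 - (x.2.1 : ℝ) ^ 2 / (x.2.2 : ℝ) ^ 2 with hD
    have hD0 : 0 < |D| := by
      by_contra hcon
      have : |D| = 0 := le_antisymm (not_lt.mp hcon) (abs_nonneg _)
      rw [this] at hslope
      linarith
    have h1 := abs_integral_comp_affine_le hH (by
        rw [integral_autoConv (integrable_kern _ _), integral_kern hκ hw, zero_mul]) hS
      (E := ratio y 0 - ratio x 0) (a := 1 / 2) (b := 1) (abs_pos.mp hD0)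
    have h2 : ∫ m, |autoConv (kern κ (1 / M)) m| ≤ 4 := by
      have h3 := integral_abs_kern_le hκ hw
      have h4 : 0 ≤ ∫ t, |kern κ (1 / M) t| := integral_nonneg fun _ => abs_nonneg _
      calc _ ≤ _ := integral_abs_autoConv_le (integrable_kern κ (1 / M))
        _ ≤ 2 * 2 := mul_le_mul h3 h3 h4 (by norm_num)
        _ = 4 := by norm_num
    simp_rw [hD, ← ratio_sub_ratio, hca] at h1
    rw [← hD] at h1
    refine h1.trans ?_
    rw [hw1]
    have h3 : |D|⁻¹ ≤ |d|⁻¹ * (625 / 2 * (M : ℝ) ^ 2) := by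
      rw [inv_mul_eq_div, inv_eq_one_div, div_le_div_iff₀ hD0 (by linarith)]
      linarith
    have h4 : (M : ℝ) ^ 2 ≤ 1 / κ := by rwa [le_div_iff₀ hκ]
    have hd0 : 0 ≤ |d|⁻¹ := by positivity
    calc _ ≤ |d|⁻¹ * (625 / 2 * (1 / κ)) * 4 * (closeAt M x y (1 / 2) + closeAt M x y 1) := by
          refine mul_le_mul_of_nonneg_right ?_ (by linarith)
          refine mul_le_mul (h3.trans ?_) h2 (integral_nonneg fun _ => abs_nonneg _)
            (by positivity)
          gcongr
      _ = |d|⁻¹ * (1250 / κ * (closeAt M x y (1 / 2) + closeAt M x y 1)) := by ring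
      _ ≤ _ := by gcongr; linarith

lemma sum_closeAt_le {M : ℕ} (hM : 0 < M) (a : ℕ) (p q : ℕ × ℕ)
    (hq : q.2 ∈ Finset.Icc M (5 * M)) (t : ℝ) :
    ∑ b ∈ Finset.Icc M (5 * M), closeAt M (a, p) (b, q) t ≤ 51 := by
  unfold closeAt
  rw [Finset.sum_boole]
  have := card_filter_sq_near_le hM hq (ratio (a, p) t) (t * (q.1 : ℝ) ^ 2)
  exact le_trans ((Nat.cast_le (α := ℝ)).mpr this) (by norm_num)

/-- Exchanging summation variables turns the determinant into a difference of two products of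
independent pairs. -/
lemma sum_detWeight_le {M : ℕ} (hM : 0 < M) :
    ∑ p ∈ Finset.Icc M (5 * M) ×ˢ Finset.Icc M (5 * M),
      ∑ q ∈ Finset.Icc M (5 * M) ×ˢ Finset.Icc M (5 * M), detWeight p q ≤
      125 * (M : ℝ) ^ 2 * harmonic (5 * M) * (1 + 2 * harmonic (5 * M * (5 * M))) := by
  set s := Finset.Icc M (5 * M) with hs
  have h1 := sum_inv_dist_mul_le (s := s) (L := 5 * M) fun a ha => (Finset.mem_Icc.mp ha).2
  have e : ∑ p ∈ s ×ˢ s, ∑ q ∈ s ×ˢ s, detWeight p q = ∑ p ∈ s ×ˢ s, ∑ q ∈ s ×ˢ s,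
      (max 1 |((p.1 * p.2 : ℕ) : ℝ) - ((q.1 * q.2 : ℕ) : ℝ)|)⁻¹ := by
    simp_rw [Finset.sum_product, detWeight]
    refine Finset.sum_congr rfl fun a _ => ?_
    exact (Finset.sum_congr rfl fun b _ => Finset.sum_comm).trans Finset.sum_comm
  rw [e]
  refine h1.trans (mul_le_mul_of_nonneg_right (sum_mulRep_le hM) ?_)
  have : (0 : ℚ) ≤ harmonic (5 * M * (5 * M)) := by
    unfold harmonic; positivity
  have : (0 : ℝ) ≤ harmonic (5 * M * (5 * M)) := by exact_mod_cast this
  linarith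

/-- For fixed `p`, `q` and first coordinate `a`, closeness leaves at most 51 choices of `b` at each
endpoint, hence 102. The hypothesis `M² * κ ≤ 1` absorbs the parallel term into `1 / κ`. -/
lemma sum_pair_le {M : ℕ} (hM : 0 < M) {κ : ℝ} (hκ : 0 < κ) (hκM : (M : ℝ) ^ 2 * κ ≤ 1) :
    ∑ x ∈ tripleBox M, ∑ y ∈ tripleBox M,
      ∫ t in (1 / 2 : ℝ)..1, autoConv (kern κ (1 / M)) (ratio y t - ratio x t) ≤
    1000000 * M / κ * ∑ p ∈ Finset.Icc M (5 * M) ×ˢ Finset.Icc M (5 * M),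
      ∑ q ∈ Finset.Icc M (5 * M) ×ˢ Finset.Icc M (5 * M), detWeight p q := by
  have hM' : (1 : ℝ) ≤ M := by exact_mod_cast hM
  set s := Finset.Icc M (5 * M) with hs
  have hcard : (s.card : ℝ) ≤ 5 * M := by
    have : s.card ≤ 5 * M := by rw [hs, Nat.card_Icc]; omega
    exact_mod_cast this
  have hinner : ∀ p ∈ s ×ˢ s, ∀ q ∈ s ×ˢ s, ∑ a ∈ s, ∑ b ∈ s,
      detWeight p q * (1250 / κ * (closeAt M (a, p) (b, q) (1 / 2) + closeAt M (a, p) (b, q) 1) + M)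
      ≤ 1000000 * M / κ * detWeight p q := by
    intro p _ q hq
    rw [Finset.mem_product] at hq
    have h1 : ∀ a ∈ s, ∑ b ∈ s, (1250 / κ * (closeAt M (a, p) (b, q) (1 / 2) +
        closeAt M (a, p) (b, q) 1) + M) ≤ 1250 / κ * 102 + 5 * M * M := by
      intro a _
      rw [Finset.sum_add_distrib, ← Finset.mul_sum, Finset.sum_add_distrib, Finset.sum_const,
        nsmul_eq_mul]
      have h2 := sum_closeAt_le hM a p q hq.2 (1 / 2)
      have h3 := sum_closeAt_le hM a p q hq.2 1
      gcongr
      linarith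
    have h4 : (M : ℝ) ^ 2 ≤ 1 / κ := by rwa [le_div_iff₀ hκ]
    have hκ' : 0 < 1 / κ := by positivity
    simp_rw [← Finset.mul_sum]
    rw [mul_comm (detWeight p q)]
    refine mul_le_mul_of_nonneg_right ?_ (detWeight_nonneg p q)
    calc _ ≤ ∑ a ∈ s, (1250 / κ * 102 + 5 * M * M : ℝ) := Finset.sum_le_sum h1
      _ = s.card * (1250 / κ * 102 + 5 * M * M) := by rw [Finset.sum_const, nsmul_eq_mul]
      _ ≤ (5 * M) * (1250 * (1 / κ) * 102 + 5 * (1 / κ)) := by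
          refine mul_le_mul hcard ?_ (by positivity) (by positivity)
          have : 1250 / κ = 1250 * (1 / κ) := by ring
          rw [this]; nlinarith
      _ = 637525 * (M * (1 / κ)) := by ring
      _ ≤ 1000000 * (M * (1 / κ)) := by
          have : 0 < M * (1 / κ) := by positivity
          linarith
      _ = _ := by ring
  calc _ ≤ ∑ x ∈ tripleBox M, ∑ y ∈ tripleBox M,
      detWeight x.2 y.2 * (1250 / κ * (closeAt M x y (1 / 2) + closeAt M x y 1) + M) :=
        Finset.sum_le_sum fun x hx => Finset.sum_le_sum fun y hy =>
          (le_abs_self _).trans (abs_integral_pair_le hM hκ hκM hx hy)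
    _ = ∑ p ∈ s ×ˢ s, ∑ q ∈ s ×ˢ s, ∑ a ∈ s, ∑ b ∈ s, detWeight p q * (1250 / κ *
          (closeAt M (a, p) (b, q) (1 / 2) + closeAt M (a, p) (b, q) 1) + M) := by
        unfold tripleBox
        rw [← hs, Finset.sum_product_right]
        refine Finset.sum_congr rfl fun p _ => ?_
        rw [Finset.sum_comm, Finset.sum_product_right]
        refine Finset.sum_congr rfl fun q _ => ?_
        rw [Finset.sum_comm]
    _ ≤ _ := by
        rw [Finset.mul_sum]
        refine Finset.sum_le_sum fun p hp => ?_
        rw [Finset.mul_sum]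
        exact Finset.sum_le_sum fun q hq => hinner p hp q hq

/-! ### The second moment. -/

/-- The smoothed count of the triples whose zero line passes near `(t, s)`. -/
noncomputable def countDiff (M : ℕ) (κ t s : ℝ) : ℝ :=
  ∑ x ∈ tripleBox M, kern κ (1 / M) (s - ratio x t)

lemma kern_mul_kern_eq (v w a b s : ℝ) :
    kern v w (s - a) * kern v w (s - b) =
      (fun u => kern v w u * kern v w ((b - a) - u)) (s - a) := by
  simp only
  rw [← kern_neg v w (s - b)]
  congr 2
  ring

lemma integrable_kern_mul_kern {v w : ℝ} (hv : 0 < v) (hw : 0 < w) (a b : ℝ) :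
    Integrable fun s => kern v w (s - a) * kern v w (s - b) := by
  simp_rw [kern_mul_kern_eq]
  exact (integrable_mul_comp_sub (integrable_kern v w) (measurable_kern v w)
    (abs_kern_le_const hv hw) (b - a)).comp_sub_right a

lemma integral_kern_mul_kern (v w a b : ℝ) :
    ∫ s, kern v w (s - a) * kern v w (s - b) = autoConv (kern v w) (b - a) := by
  simp_rw [kern_mul_kern_eq]
  exact integral_sub_right_eq_self (fun u => kern v w u * kern v w ((b - a) - u)) a

lemma countDiff_sq (M : ℕ) (κ t s : ℝ) : countDiff M κ t s ^ 2 =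
    ∑ x ∈ tripleBox M, ∑ y ∈ tripleBox M,
      kern κ (1 / M) (s - ratio x t) * kern κ (1 / M) (s - ratio y t) := by
  rw [sq, countDiff, Finset.sum_mul_sum]

lemma integrable_countDiff_sq {M : ℕ} (hM : 0 < M) {κ : ℝ} (hκ : 0 < κ) (t : ℝ) :
    Integrable fun s => countDiff M κ t s ^ 2 := by
  have hw : (0 : ℝ) < 1 / M := by positivity
  simp_rw [countDiff_sq]
  exact integrable_finsetSum _ fun x _ => integrable_finsetSum _ fun y _ =>
    integrable_kern_mul_kern hκ hw _ _

lemma integral_countDiff_sq {M : ℕ} (hM : 0 < M) {κ : ℝ} (hκ : 0 < κ) (t : ℝ) :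
    ∫ s, countDiff M κ t s ^ 2 = ∑ x ∈ tripleBox M, ∑ y ∈ tripleBox M,
      autoConv (kern κ (1 / M)) (ratio y t - ratio x t) := by
  have hw : (0 : ℝ) < 1 / M := by positivity
  simp_rw [countDiff_sq]
  rw [integral_finsetSum _ fun x _ => integrable_finsetSum _ fun y _ =>
    integrable_kern_mul_kern hκ hw _ _]
  refine Finset.sum_congr rfl fun x _ => ?_
  rw [integral_finsetSum _ fun y _ => integrable_kern_mul_kern hκ hw _ _]
  exact Finset.sum_congr rfl fun y _ => integral_kern_mul_kern _ _ _ _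

lemma intervalIntegrable_comp_affine {H : ℝ → ℝ} (hH : Integrable H) (E D a b : ℝ) :
    IntervalIntegrable (fun t => H (E + D * t)) volume a b := by
  rcases eq_or_ne D 0 with rfl | hD
  · simp
  · exact ((hH.comp_add_left E).comp_mul_left' hD).intervalIntegrable

lemma intervalIntegrable_autoConv_ratio (v w : ℝ) (x y : ℕ × ℕ × ℕ) (a b : ℝ) :
    IntervalIntegrable (fun t => autoConv (kern v w) (ratio y t - ratio x t)) volume a b := by
  rw [funext fun t => congrArg (autoConv (kern v w)) (ratio_sub_ratio x y t)]
  exact intervalIntegrable_comp_affine (integrable_autoConv (integrable_kern v w)) _ _ _ _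

lemma lintegral_countDiff_sq_le {M : ℕ} (hM : 0 < M) {κ : ℝ} (hκ : 0 < κ)
    (hκM : (M : ℝ) ^ 2 * κ ≤ 1) :
    ∫⁻ t in Icc (1 / 2 : ℝ) 1, ∫⁻ s, ENNReal.ofReal (countDiff M κ t s ^ 2) ≤
      ENNReal.ofReal (1000000 * M / κ * ∑ p ∈ Finset.Icc M (5 * M) ×ˢ Finset.Icc M (5 * M),
        ∑ q ∈ Finset.Icc M (5 * M) ×ˢ Finset.Icc M (5 * M), detWeight p q) := by
  have h1 : ∀ t, ∫⁻ s, ENNReal.ofReal (countDiff M κ t s ^ 2) =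
      ENNReal.ofReal (∫ s, countDiff M κ t s ^ 2) := fun t =>
    (ofReal_integral_eq_lintegral_ofReal (integrable_countDiff_sq hM hκ t)
      (Filter.Eventually.of_forall fun s => sq_nonneg _)).symm
  have h2 : ∀ x y, IntegrableOn (fun t => autoConv (kern κ (1 / M)) (ratio y t - ratio x t))
      (Icc (1 / 2 : ℝ) 1) := fun x y => by
    rw [integrableOn_Icc_iff_integrableOn_Ioc]
    exact (intervalIntegrable_autoConv_ratio κ (1 / M) x y (1 / 2) 1).1
  have h3 : IntegrableOn (fun t => ∫ s, countDiff M κ t s ^ 2) (Icc (1 / 2 : ℝ) 1) := by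
    simp_rw [integral_countDiff_sq hM hκ]
    exact integrable_finsetSum _ fun x _ => integrable_finsetSum _ fun y _ => h2 x y
  simp_rw [h1]
  rw [← ofReal_integral_eq_lintegral_ofReal h3
    (Filter.Eventually.of_forall fun t => integral_nonneg fun s => sq_nonneg _)]
  refine ENNReal.ofReal_le_ofReal (le_trans (le_of_eq ?_) (sum_pair_le hM hκ hκM))
  simp_rw [integral_countDiff_sq hM hκ]
  rw [integral_finsetSum _ fun x _ => integrable_finsetSum _ fun y _ => h2 x y]
  refine Finset.sum_congr rfl fun x _ => ?_
  rw [integral_finsetSum _ fun y _ => h2 x y]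
  refine Finset.sum_congr rfl fun y _ => ?_
  rw [integral_Icc_eq_integral_Ioc, intervalIntegral.integral_of_le (by norm_num)]

/-! ### Lower bound for the coarse count. -/

/-- The ranges of `b` and `c` force `4 * M² ≤ s * c² - t * b² ≤ 25 * M²`, so its integer square root
`a` is admissible. The remainder is below `2 * a + 1`, and division by `c² ≥ 16 * M²` brings it
under `1 / M`. -/
lemma exists_ratio_near {M b c : ℕ} (hM : 0 < M) (hb : b ∈ Finset.Ico M (2 * M))
    (hc : c ∈ Finset.Ico (4 * M) (5 * M)) {t s : ℝ} (ht : t ∈ Icc (1 / 2 : ℝ) 1)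
    (hs : s ∈ Icc (1 / 2 : ℝ) 1) :
    ∃ a ∈ Finset.Icc M (5 * M), |s - ratio (a, b, c) t| ≤ 1 / M := by
  rw [Finset.mem_Ico] at hb hc
  have hM' : (1 : ℝ) ≤ M := by exact_mod_cast hM
  have hb2 : (b : ℝ) ≤ 2 * M := by exact_mod_cast hb.2.le
  have hc1 : (4 * M : ℝ) ≤ c := by exact_mod_cast hc.1
  have hc2 : (c : ℝ) ≤ 5 * M := by exact_mod_cast hc.2.le
  have hb0 : (0 : ℝ) ≤ b := by positivity
  set T := s * (c : ℝ) ^ 2 - t * (b : ℝ) ^ 2 with hT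
  have hc1' : 16 * (M : ℝ) ^ 2 ≤ (c : ℝ) ^ 2 := by nlinarith
  have hc2' : (c : ℝ) ^ 2 ≤ 25 * (M : ℝ) ^ 2 := by nlinarith
  have hb2' : (b : ℝ) ^ 2 ≤ 4 * (M : ℝ) ^ 2 := by nlinarith
  have hT1 : 4 * (M : ℝ) ^ 2 ≤ T := by
    have h1 : 1 / 2 * (c : ℝ) ^ 2 ≤ s * (c : ℝ) ^ 2 := by gcongr; exact hs.1
    have h2 : t * (b : ℝ) ^ 2 ≤ 1 * (b : ℝ) ^ 2 := by gcongr; exact ht.2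
    linarith
  have hT2 : T ≤ 25 * (M : ℝ) ^ 2 := by
    have h1 : s * (c : ℝ) ^ 2 ≤ 1 * (c : ℝ) ^ 2 := by gcongr; exact hs.2
    have h2 : 0 ≤ t * (b : ℝ) ^ 2 := mul_nonneg (by linarith [ht.1]) (by positivity)
    linarith
  have hT0 : 0 ≤ T := le_trans (by positivity) hT1
  set a := Nat.sqrt ⌊T⌋₊ with ha
  have h1 : (a : ℝ) ^ 2 ≤ T := by
    refine le_trans ?_ (Nat.floor_le hT0)
    exact_mod_cast Nat.sqrt_le' ⌊T⌋₊
  have h2 : T < ((a : ℝ) + 1) ^ 2 := by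
    refine (Nat.lt_floor_add_one T).trans_le ?_
    have := Nat.lt_succ_sqrt' ⌊T⌋₊
    exact_mod_cast Nat.succ_le_of_lt this
  have ha0 : (0 : ℝ) ≤ a := by positivity
  have ha1 : (M : ℝ) ≤ a := by nlinarith
  have ha2 : (a : ℝ) ≤ 5 * M := by nlinarith
  refine ⟨a, Finset.mem_Icc.mpr ⟨by exact_mod_cast ha1, by exact_mod_cast ha2⟩, ?_⟩
  have hc0 : (0 : ℝ) < c := by linarith
  have e : s - ratio (a, b, c) t = (T - (a : ℝ) ^ 2) / (c : ℝ) ^ 2 := by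
    simp only [ratio, hT]
    field_simp
    ring
  rw [e, abs_of_nonneg (div_nonneg (by linarith) (by positivity)),
    div_le_div_iff₀ (by positivity) (by linarith)]
  nlinarith

lemma le_sum_window {M : ℕ} (hM : 0 < M) {t s : ℝ} (ht : t ∈ Icc (1 / 2 : ℝ) 1)
    (hs : s ∈ Icc (1 / 2 : ℝ) 1) :
    (M : ℝ) ^ 3 / 2 ≤ ∑ x ∈ tripleBox M, window (1 / M) (s - ratio x t) := by
  have hM' : (1 : ℝ) ≤ M := by exact_mod_cast hM
  have hw : (0 : ℝ) < 1 / M := by positivity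
  unfold tripleBox
  rw [Finset.sum_product_right]
  have hsub : Finset.Ico M (2 * M) ×ˢ Finset.Ico (4 * M) (5 * M) ⊆
      Finset.Icc M (5 * M) ×ˢ Finset.Icc M (5 * M) := by
    refine Finset.product_subset_product ?_ ?_
    · intro b hb
      rw [Finset.mem_Ico] at hb
      exact Finset.mem_Icc.mpr ⟨hb.1, by omega⟩
    · intro b hb
      rw [Finset.mem_Ico] at hb
      exact Finset.mem_Icc.mpr ⟨by omega, by omega⟩
  refine le_trans ?_ (Finset.sum_le_sum_of_subset_of_nonneg hsub fun _ _ _ =>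
    Finset.sum_nonneg fun _ _ => window_nonneg hw _)
  have h1 : ∀ p ∈ Finset.Ico M (2 * M) ×ˢ Finset.Ico (4 * M) (5 * M), (M : ℝ) / 2 ≤
      ∑ a ∈ Finset.Icc M (5 * M), window (1 / M) (s - ratio (a, p) t) := by
    intro p hp
    rw [Finset.mem_product] at hp
    obtain ⟨a, ha, hle⟩ := exists_ratio_near hM hp.1 hp.2 ht hs
    refine le_trans (le_of_eq ?_) (Finset.single_le_sum (fun a _ => window_nonneg hw _) ha)
    rw [window_of_abs_le hle]
    field_simp
  refine le_trans (le_of_eq ?_) (Finset.sum_le_sum h1)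
  rw [Finset.sum_const, nsmul_eq_mul, Finset.card_product, Nat.card_Ico, Nat.card_Ico,
    show 2 * M - M = M by omega, show 5 * M - 4 * M = M by omega]
  push_cast
  ring

/-! ### Measure of the bad set and Borel–Cantelli. -/

/-- The parameters for which no triple of the box gives a value `ratio` within `κ` of `α₃`. -/
def badSet (M : ℕ) (κ : ℝ) : Set (ℝ × ℝ) :=
  {α | α ∈ Icc (1 / 2 : ℝ) 1 ×ˢ Icc (1 / 2 : ℝ) 1 ∧ ∀ x ∈ tripleBox M, κ < |α.2 - ratio x α.1|}

lemma le_countDiff_sq_of_mem_badSet {M : ℕ} (hM : 0 < M) {κ : ℝ} {α : ℝ × ℝ}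
    (hα : α ∈ badSet M κ) : (M : ℝ) ^ 6 / 4 ≤ countDiff M κ α.1 α.2 ^ 2 := by
  have h1 := le_sum_window hM hα.1.1 hα.1.2
  have h2 : countDiff M κ α.1 α.2 = -∑ x ∈ tripleBox M, window (1 / M) (α.2 - ratio x α.1) := by
    rw [countDiff, ← Finset.sum_neg_distrib]
    refine Finset.sum_congr rfl fun x hx => ?_
    rw [kern, window_of_lt_abs (hα.2 x hx), zero_sub]
  rw [h2, neg_sq]
  calc (M : ℝ) ^ 6 / 4 = ((M : ℝ) ^ 3 / 2) ^ 2 := by ring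
    _ ≤ _ := by gcongr

lemma measurable_countDiff (M : ℕ) (κ : ℝ) :
    Measurable fun α : ℝ × ℝ => countDiff M κ α.1 α.2 := by
  unfold countDiff ratio
  refine Finset.measurable_fun_sum _ fun x _ => (measurable_kern κ (1 / M)).comp ?_
  fun_prop

lemma volume_badSet_le {M : ℕ} (hM : 0 < M) {κ : ℝ} (hκ : 0 < κ) (hκM : (M : ℝ) ^ 2 * κ ≤ 1) :
    volume (badSet M κ) ≤ ENNReal.ofReal (4000000 / (κ * (M : ℝ) ^ 5) *
      ∑ p ∈ Finset.Icc M (5 * M) ×ˢ Finset.Icc M (5 * M),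
        ∑ q ∈ Finset.Icc M (5 * M) ×ˢ Finset.Icc M (5 * M), detWeight p q) := by
  set W := ∑ p ∈ Finset.Icc M (5 * M) ×ˢ Finset.Icc M (5 * M),
        ∑ q ∈ Finset.Icc M (5 * M) ×ˢ Finset.Icc M (5 * M), detWeight p q with hW
  have hM' : (0 : ℝ) < M := by exact_mod_cast hM
  have hmeas : Measurable fun α : ℝ × ℝ => ENNReal.ofReal (countDiff M κ α.1 α.2 ^ 2) :=
    ((measurable_countDiff M κ).pow_const 2).ennreal_ofReal
  -- The second coordinate is left unrestricted because the second moment was computed over the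
  -- whole line in `s`.
  set μ : Measure (ℝ × ℝ) := (volume.restrict (Icc (1 / 2 : ℝ) 1)).prod volume with hμ
  have h1 : volume (badSet M κ) ≤ μ (badSet M κ) := by
    have e : μ = (volume : Measure (ℝ × ℝ)).restrict (Icc (1 / 2 : ℝ) 1 ×ˢ univ) := by
      rw [hμ, Measure.volume_eq_prod, ← Measure.prod_restrict, Measure.restrict_univ]
    rw [e]
    refine le_trans (measure_mono ?_) (Measure.le_restrict_apply _ _)
    exact fun α hα => ⟨hα, hα.1.1, mem_univ _⟩
  have h2 : μ (badSet M κ) ≤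
      μ {α | ENNReal.ofReal ((M : ℝ) ^ 6 / 4) ≤ ENNReal.ofReal (countDiff M κ α.1 α.2 ^ 2)} :=
    measure_mono fun α hα => ENNReal.ofReal_le_ofReal (le_countDiff_sq_of_mem_badSet hM hα)
  have h3 := mul_meas_ge_le_lintegral (μ := μ) hmeas (ENNReal.ofReal ((M : ℝ) ^ 6 / 4))
  rw [hμ, lintegral_prod _ hmeas.aemeasurable] at h3
  have h4 := h3.trans (lintegral_countDiff_sq_le hM hκ hκM)
  refine h1.trans (h2.trans ?_)
  have hpos : (0 : ℝ) < (M : ℝ) ^ 6 / 4 := by positivity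
  rw [mul_comm, ← ENNReal.le_div_iff_mul_le (Or.inl (by simpa using hpos)) (Or.inl (by simp)),
    ← ENNReal.ofReal_div_of_pos hpos] at h4
  refine h4.trans (le_of_eq ?_)
  congr 1
  rw [← hW]
  field_simp
  ring

lemma harmonic_two_pow_le {n L k : ℕ} (hn : n ≤ L) (hn0 : 0 < n) (hL : L ≤ 2 ^ k) :
    (harmonic n : ℝ) ≤ k + 1 := by
  have h1 : Real.log n ≤ k := by
    have h2 : (n : ℝ) ≤ 2 ^ k := by exact_mod_cast hn.trans hL
    have h3 := Real.log_le_log (by exact_mod_cast hn0) h2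
    rw [Real.log_pow] at h3
    have h4 : Real.log 2 ≤ 1 := by linarith [Real.log_two_lt_d9]
    have h5 : (k : ℝ) * Real.log 2 ≤ k * 1 := by gcongr
    linarith
  linarith [harmonic_le_one_add_log n]

/-- With `B = 2 ^ ε`, this `κ` makes `25 * M² * κ` equal to `M ^ (-1 + ε)`. The condition `B ≤ 2`
ensures `M² * κ ≤ 1`. -/
lemma volume_badSet_two_pow_le {B : ℝ} (hB : 0 < B) (hB2 : B ≤ 2) (k : ℕ) :
    volume (badSet (2 ^ k) (B ^ k / (25 * ((2 : ℝ) ^ k) ^ 3))) ≤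
      ENNReal.ofReal (150000000000 * (((k : ℝ) + 3) ^ 2 * B⁻¹ ^ k)) := by
  have hM : 0 < 2 ^ k := by positivity
  have h2k : (1 : ℝ) ≤ 2 ^ k := one_le_pow₀ (by norm_num)
  have hcast : ((2 ^ k : ℕ) : ℝ) = 2 ^ k := by push_cast; ring
  have hBk : B ^ k ≤ 2 ^ k := pow_le_pow_left₀ hB.le hB2 k
  have hBk0 : 0 < B ^ k := by positivity
  have h1 := volume_badSet_le hM (κ := B ^ k / (25 * ((2 : ℝ) ^ k) ^ 3)) (by positivity) (by
    rw [hcast, mul_div_assoc', div_le_one (by positivity)]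
    nlinarith [mul_le_mul_of_nonneg_left hBk (sq_nonneg ((2 : ℝ) ^ k)),
      pow_pos (lt_of_lt_of_le zero_lt_one h2k) 3])
  refine h1.trans (ENNReal.ofReal_le_ofReal ?_)
  have h2 := sum_detWeight_le hM
  set W := ∑ p ∈ Finset.Icc (2 ^ k) (5 * 2 ^ k) ×ˢ Finset.Icc (2 ^ k) (5 * 2 ^ k),
        ∑ q ∈ Finset.Icc (2 ^ k) (5 * 2 ^ k) ×ˢ Finset.Icc (2 ^ k) (5 * 2 ^ k), detWeight p q
  have hp : 1 ≤ 2 ^ k := Nat.one_le_two_pow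
  -- The exponent rounds 25 up to 32, and `(2 * k + 5) + 1 = 2 * (k + 3)` then bounds both harmonic
  -- numbers.
  have e1 : 5 * 2 ^ k * (5 * 2 ^ k) ≤ 2 ^ (2 * k + 5) := by
    rw [pow_add, pow_mul', sq]
    nlinarith
  have h3 : (harmonic (5 * 2 ^ k) : ℝ) ≤ 2 * (k + 3) := by
    have := harmonic_two_pow_le (n := 5 * 2 ^ k) (show 5 * 2 ^ k ≤ 5 * 2 ^ k * (5 * 2 ^ k) by
      nlinarith) (by positivity) e1
    push_cast at this; linarith
  have h4 : (harmonic (5 * 2 ^ k * (5 * 2 ^ k)) : ℝ) ≤ 2 * (k + 3) := by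
    have := harmonic_two_pow_le (n := 5 * 2 ^ k * (5 * 2 ^ k)) le_rfl (by positivity) e1
    push_cast at this; linarith
  have h5 : (0 : ℝ) ≤ harmonic (5 * 2 ^ k * (5 * 2 ^ k)) := by
    have : (0 : ℚ) ≤ harmonic (5 * 2 ^ k * (5 * 2 ^ k)) := by unfold harmonic; positivity
    exact_mod_cast this
  rw [hcast] at h2
  have hk : (0 : ℝ) ≤ k := by positivity
  have hW : W ≤ 1500 * ((2 : ℝ) ^ k) ^ 2 * (k + 3) ^ 2 := by
    calc W ≤ _ := h2
      _ ≤ 125 * ((2 : ℝ) ^ k) ^ 2 * (2 * (k + 3)) * (1 + 2 * (2 * (k + 3))) := by gcongr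
      _ ≤ 125 * ((2 : ℝ) ^ k) ^ 2 * (2 * (k + 3)) * (6 * (k + 3)) := by gcongr; linarith
      _ = _ := by ring
  rw [hcast]
  calc _ ≤ 4000000 / (B ^ k / (25 * ((2 : ℝ) ^ k) ^ 3) * ((2 : ℝ) ^ k) ^ 5) *
        (1500 * ((2 : ℝ) ^ k) ^ 2 * (k + 3) ^ 2) := by gcongr
    _ = _ := by
        rw [inv_pow]
        field_simp
        norm_num

lemma summable_sq_mul_geometric {r : ℝ} (hr : ‖r‖ < 1) :
    Summable fun k : ℕ => ((k : ℝ) + 3) ^ 2 * r ^ k := by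
  have h0 := summable_pow_mul_geometric_of_norm_lt_one 0 hr
  have h1 := summable_pow_mul_geometric_of_norm_lt_one 1 hr
  have h2 := summable_pow_mul_geometric_of_norm_lt_one 2 hr
  refine ((h2.add (h1.mul_left 6)).add (h0.mul_left 9)).congr fun k => ?_
  ring

lemma ae_eventually_notMem_badSet {B : ℝ} (hB : 1 < B) (hB2 : B ≤ 2) :
    ∀ᵐ α : ℝ × ℝ, ∀ᶠ k : ℕ in Filter.atTop,
      α ∉ badSet (2 ^ k) (B ^ k / (25 * ((2 : ℝ) ^ k) ^ 3)) := by
  have hB0 : 0 < B := zero_lt_one.trans hB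
  refine ae_eventually_notMem (ne_top_of_le_ne_top ?_
    (ENNReal.tsum_le_tsum (volume_badSet_two_pow_le hB0 hB2)))
  refine Summable.tsum_ofReal_ne_top ((summable_sq_mul_geometric ?_).mul_left _)
  rw [norm_inv, Real.norm_of_nonneg hB0.le]
  exact inv_lt_one_of_one_lt₀ hB

/-! ### From the bad set to the minimum of the form. -/

lemma euclNorm_sq (x : Fin 3 → ℤ) :
    euclNorm x ^ 2 = (x 0 : ℝ) ^ 2 + (x 1 : ℝ) ^ 2 + (x 2 : ℝ) ^ 2 := by
  rw [euclNorm, EuclideanSpace.norm_sq_eq, Fin.sum_univ_three]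
  simp

lemma euclNorm_nonneg (x : Fin 3 → ℤ) : 0 ≤ euclNorm x := norm_nonneg _

lemma one_mem_absValues (α₂ α₃ : ℝ) {N : ℝ} (hN : 1 < N) : 1 ∈ absValues α₂ α₃ N := by
  have h := euclNorm_sq ![1, 0, 0]
  have h0 := euclNorm_nonneg ![1, 0, 0]
  have e : (![1, 0, 0] : Fin 3 → ℤ) 2 = 0 := rfl
  norm_num [e] at h
  have h1 : euclNorm ![1, 0, 0] = 1 := by
    rcases h with h | h <;> linarith
  exact ⟨![1, 0, 0], by rw [h1]; norm_num, by rwa [h1], by norm_num [diagForm, e]⟩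

lemma finite_absValues (α₂ α₃ N : ℝ) : (absValues α₂ α₃ N).Finite := by
  refine ((Set.finite_Icc (fun _ : Fin 3 => -⌈N⌉) (fun _ => ⌈N⌉)).image
    fun x => |diagForm α₂ α₃ x|).subset ?_
  rintro v ⟨x, _, hx, rfl⟩
  refine ⟨x, ?_, rfl⟩
  have h : ∀ i, |x i| ≤ ⌈N⌉ := by
    intro i
    have h1 : ‖(x i : ℝ)‖ ≤ euclNorm x :=
      PiLp.norm_apply_le (WithLp.toLp 2 (fun i => (x i : ℝ)) : EuclideanSpace ℝ (Fin 3)) i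
    rw [Real.norm_eq_abs] at h1
    have h2 : |(x i : ℝ)| ≤ ⌈N⌉ := h1.trans (hx.le.trans (Int.le_ceil N))
    exact_mod_cast h2
  exact ⟨fun i => (abs_le.mp (h i)).1, fun i => (abs_le.mp (h i)).2⟩

lemma exists_isLeast_absValues (α₂ α₃ : ℝ) {N : ℝ} (hN : 1 < N) :
    ∃ m, IsLeast (absValues α₂ α₃ N) m :=
  (finite_absValues α₂ α₃ N).exists_minimal ⟨1, one_mem_absValues α₂ α₃ hN⟩ |>.imp
    fun _ hm => ⟨hm.1, fun v hv => (le_total _ v).elim id (fun h => hm.2 hv h)⟩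

lemma exists_mem_absValues_le {M : ℕ} (hM : 0 < M) {κ N : ℝ} {α : ℝ × ℝ}
    (hα : α ∈ Icc (1 / 2 : ℝ) 1 ×ˢ Icc (1 / 2 : ℝ) 1) (hbad : α ∉ badSet M κ)
    (hN : 10 * (M : ℝ) ≤ N) : ∃ v ∈ absValues α.1 α.2 N, v ≤ 25 * (M : ℝ) ^ 2 * κ := by
  have hM' : (0 : ℝ) < M := by exact_mod_cast hM
  obtain ⟨⟨a, b, c⟩, hx, hle⟩ : ∃ x ∈ tripleBox M, |α.2 - ratio x α.1| ≤ κ := by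
    by_contra! hcon
    exact hbad ⟨hα, hcon⟩
  simp only [tripleBox, Finset.mem_product] at hx
  obtain ⟨ha1, ha2⟩ := le_cast_of_mem hx.1
  obtain ⟨hb1, hb2⟩ := le_cast_of_mem hx.2.1
  obtain ⟨hc1, hc2⟩ := le_cast_of_mem hx.2.2
  have h0 := euclNorm_nonneg ![(a : ℤ), b, c]
  have h := euclNorm_sq ![(a : ℤ), b, c]
  simp only [Matrix.cons_val_zero, Matrix.cons_val_one, Matrix.cons_val, Int.cast_natCast] at h
  refine ⟨_, ⟨![(a : ℤ), b, c], ?_, ?_, rfl⟩, ?_⟩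
  · refine lt_of_le_of_ne h0 fun h1 => ?_
    rw [← h1] at h
    nlinarith
  · refine lt_of_lt_of_le ?_ hN
    nlinarith
  · have hc0 : (0 : ℝ) < c := by linarith
    have e : diagForm α.1 α.2 ![(a : ℤ), b, c] = -((c : ℝ) ^ 2 * (α.2 - ratio (a, b, c) α.1)) := by
      simp only [diagForm, ratio, Matrix.cons_val_zero, Matrix.cons_val_one, Matrix.cons_val,
        Int.cast_natCast]
      field_simp
      ring
    rw [e, abs_neg, abs_mul, abs_of_nonneg (sq_nonneg (c : ℝ))]
    have hc : (c : ℝ) ^ 2 ≤ 25 * (M : ℝ) ^ 2 := by nlinarith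
    exact mul_le_mul hc hle (abs_nonneg _) (by positivity)

lemma exists_const_of_eventually_notMem {ε : ℝ} (hε : 0 < ε) (hε1 : ε ≤ 1) {α : ℝ × ℝ}
    (hα : α ∈ Icc (1 / 2 : ℝ) 1 ×ˢ Icc (1 / 2 : ℝ) 1)
    (h : ∀ᶠ k : ℕ in Filter.atTop,
      α ∉ badSet (2 ^ k) (((2 : ℝ) ^ ε) ^ k / (25 * ((2 : ℝ) ^ k) ^ 3))) :
    ∃ C : ℝ, 0 < C ∧ ∀ N : ℝ, 1 < N → ∃ m : ℝ, IsLeast (absValues α.1 α.2 N) m ∧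
      m ≤ C * N ^ (-1 + ε) := by
  obtain ⟨k₀, hk₀⟩ := Filter.eventually_atTop.mp h
  have hpos : (1 : ℝ) ≤ 2 ^ k₀ := one_le_pow₀ (by norm_num)
  -- For `N < 10 * 2 ^ k₀` the value 1 at `(1, 0, 0)` suffices. For larger `N`, the dyadic `2 ^ k`
  -- with `2 ^ k ≤ N / 10 < 2 ^ (k + 1)` loses at most a factor 20.
  refine ⟨20 * 2 ^ k₀, by positivity, fun N hN => ?_⟩
  have hN0 : 0 < N := by linarith
  obtain ⟨m, hm⟩ := exists_isLeast_absValues α.1 α.2 hN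
  refine ⟨m, hm, ?_⟩
  rcases lt_or_ge N (10 * 2 ^ k₀) with hlt | hge
  · have h1 : N⁻¹ ≤ N ^ (-1 + ε) := by
      rw [← Real.rpow_neg_one]
      exact Real.rpow_le_rpow_of_exponent_le hN.le (by linarith)
    have h2 : 1 ≤ 20 * 2 ^ k₀ * N⁻¹ := by
      rw [← div_eq_mul_inv, le_div_iff₀ hN0]; linarith
    exact (hm.2 (one_mem_absValues α.1 α.2 hN)).trans (h2.trans (by gcongr))
  · obtain ⟨k, hk1, hk2⟩ := exists_nat_pow_near (x := N / 10) (y := 2) (by linarith) (by norm_num)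
    have hk : k₀ ≤ k := by
      have h1 : (2 : ℝ) ^ k₀ < 2 ^ (k + 1) := by linarith
      exact Nat.lt_succ_iff.mp ((pow_lt_pow_iff_right₀ (by norm_num)).mp h1)
    obtain ⟨v, hv, hle⟩ := exists_mem_absValues_le (M := 2 ^ k) (N := N) (by positivity) hα
      (hk₀ k hk) (by push_cast; linarith)
    have h2k : (0 : ℝ) < 2 ^ k := by positivity
    have e : 25 * (((2 ^ k : ℕ) : ℝ)) ^ 2 * (((2 : ℝ) ^ ε) ^ k / (25 * ((2 : ℝ) ^ k) ^ 3)) =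
        ((2 : ℝ) ^ k) ^ (-1 + ε) := by
      have e1 : ((2 : ℝ) ^ ε) ^ k = ((2 : ℝ) ^ k) ^ ε := by
        rw [← Real.rpow_natCast, ← Real.rpow_mul (by norm_num), mul_comm, Real.rpow_mul (by norm_num),
          Real.rpow_natCast]
      rw [e1, Real.rpow_add h2k, Real.rpow_neg_one]
      push_cast
      field_simp
    rw [e] at hle
    have h3 : N / 20 ≤ 2 ^ k := by rw [pow_succ] at hk2; linarith
    calc m ≤ v := hm.2 hv
      _ ≤ _ := hle
      _ ≤ (N / 20) ^ (-1 + ε) :=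
          Real.rpow_le_rpow_of_nonpos (by linarith) h3 (by linarith)
      _ = (20 : ℝ) ^ (1 - ε) * N ^ (-1 + ε) := by
          rw [Real.div_rpow hN0.le (by norm_num), div_eq_mul_inv, ← Real.rpow_neg (by norm_num),
            mul_comm]
          congr 2; ring
      _ ≤ 20 * 2 ^ k₀ * N ^ (-1 + ε) := by
          have h4 : (20 : ℝ) ^ (1 - ε) ≤ 20 ^ (1 : ℝ) :=
            Real.rpow_le_rpow_of_exponent_le (by norm_num) (by linarith)
          rw [Real.rpow_one] at h4
          have h5 : (20 : ℝ) ^ (1 - ε) ≤ 20 * 2 ^ k₀ := by linarith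
          gcongr

theorem mainTheorem3 :
    ∀ᵐ α : ℝ × ℝ ∂((volume : Measure (ℝ × ℝ)).restrict
        (Icc (1 / 2 : ℝ) 1 ×ˢ Icc (1 / 2 : ℝ) 1)),
      ∀ ε : ℝ, 0 < ε → ∃ C : ℝ, 0 < C ∧ ∀ N : ℝ, 1 < N →
        ∃ m : ℝ, IsLeast (absValues α.1 α.2 N) m ∧ m ≤ C * N ^ (-1 + ε) := by
  -- The exponents `1 / (n + 1)` give countably many null sets and reach below every positive `ε`.
  have h1 : ∀ᵐ α : ℝ × ℝ, ∀ n : ℕ, ∀ᶠ k : ℕ in Filter.atTop,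
      α ∉ badSet (2 ^ k) (((2 : ℝ) ^ (1 / ((n : ℝ) + 1))) ^ k / (25 * ((2 : ℝ) ^ k) ^ 3)) := by
    refine ae_all_iff.mpr fun n => ae_eventually_notMem_badSet ?_ ?_
    · exact Real.one_lt_rpow (by norm_num) (by positivity)
    · refine (Real.rpow_le_rpow_of_exponent_le (by norm_num) (?_ : 1 / ((n : ℝ) + 1) ≤ 1)).trans
        (Real.rpow_one 2).le
      rw [div_le_one (by positivity)]
      linarith [(Nat.cast_nonneg n : (0 : ℝ) ≤ n)]
  filter_upwards [ae_restrict_of_ae h1,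
    ae_restrict_mem (measurableSet_Icc.prod measurableSet_Icc)] with α hα hmem ε hε
  obtain ⟨n, hn⟩ := exists_nat_one_div_lt hε
  have hn1 : 1 / ((n : ℝ) + 1) ≤ 1 := by
    rw [div_le_one (by positivity)]
    linarith [(Nat.cast_nonneg n : (0 : ℝ) ≤ n)]
  obtain ⟨C, hC, hbound⟩ := exists_const_of_eventually_notMem (by positivity) hn1 hmem (hα n)
  refine ⟨C, hC, fun N hN => ?_⟩
  obtain ⟨m, hm, hle⟩ := hbound N hN
  refine ⟨m, hm, hle.trans (mul_le_mul_of_nonneg_left ?_ hC.le)⟩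
  exact Real.rpow_le_rpow_of_exponent_le hN.le (by linarith)
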